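/- Let $R$ be a commutative ring. For a simplicial set $X$, let $\Delta(X)$ be its category of simplices: objects are pairs $([n],\sigma)$ with $\sigma\in X_n$, and morphisms $f:([m],\tau)\to([n],\sigma)$ are the morphisms $f:[m]\to[n]$ in the simplex category with $f^*\sigma=\tau$. A coefficient system for $X$ is a functor $\mathcal M:\Delta(X)\to R\text{-Mod}$, and $H^*(X;\mathcal M)$ denotes the cohomology of the cochain complex $$C^n(X;\mathcal M)=\prod_{\sigma\in X_n}\mathcal M(\sigma),\qquad (\delta c)(\sigma)=\sum_{i}(-1)^i\, d^i_*\bigl(c(d_i\sigma)\bigr).$$ A simplicial map $\lambda:X\to Y$ induces a functor $\Delta(\lambda):\Delta(X)\to\Delta(Y)$; put $\lambda^*\mathcal M=\mathcal M\circ\Delta(\lambda)$ and let $\lambda^*:H^*(Y;\mathcal M)\to H^*(X;\lambda^*\mathcal M)$ be the homomorphism induced by $(\lambda^*c)(\sigma)=c(\lambda(\sigma))$. For a small category $\mathcal C$ with nerve $N\mathcal C$ and a coefficient system $\mathcal M$ for $N\mathcal C$, the Thomason cohomology is $H^*_{Th}(\mathcal C;\mathcal M)=H^*(N\mathcal C;\mathcal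 M)$. For a functor $F:\mathcal E\to sSet$ on a small category, $\operatorname{hocolim}_{\mathcal E}F$ is the diagonal of the bisimplicial set with $(p,q)$-simplices the pairs $(\sigma,x)$, where $\sigma=(e_0\to\cdots\to e_p)\in N\mathcal E_p$ and $x\in F(e_0)_q$, and with structure maps $(f_h,f_v)^*(\sigma,x)=(f_h^*\sigma,\,F(e_0\to e_{f_h(0)})(f_v^*x))$. **Theorem.** Let $\varphi:\mathcal C\to\mathcal D$ be a functor between small categories, and let $-\backslash\varphi:\mathcal D^{op}\to Cat$ be the functor that sends $d$ to the comma category $d\backslash\varphi$, whose objects are the pairs $(c,\mu)$ with $c\in\mathcal C$ and $\mu:d\to\varphi(c)$. Let $Y=\operatorname{hocolim}_{\mathcal D^{op}}N(-\backslash\varphi)$, and let $\upsilon:Y\to N\mathcal C$ be the canonical simplicial map (known by Quillen to be a homotopy equivalence) which sends $(\sigma,x)$, with $\sigma=(d_0\to\cdots\to d_n)\in N(\mathcal D^{op})_n$ and $x\in N(d_0\backslash\varphi)_n$, to the image of $x$ under the projection $d_0\backslash\varphi\to\mathcal C$, $(c,\mu)\mapsto c$. Then for every coefficient system $\mathcal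 M:\Delta(N\mathcal C)\to R\text{-Mod}$, the induced homomorphism $$\upsilon^*:H^n_{Th}(\mathcal C;\mathcal M)\longrightarrow H^n(Y;\upsilon^*\mathcal M)$$ is an isomorphism of $R$-modules for every $n\ge 0$. -/

import Mathlib

open CategoryTheory Opposite Simplicial

universe w' w u

namespace ThomasonCohomology

section CoefficientSystems

/-- The category of simplices `Δ(X)` of a simplicial set `X`: its objects are the pairs `([n], σ)`
with `σ ∈ X_n`, and its morphisms `([m], τ) ⟶ ([n], σ)` are the morphisms `f : [m] ⟶ [n]` of the
simplex category such that `f^* σ = τ`. -/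
abbrev SimplicesCat (X : SSet.{u}) : Type u := X.Elementsᵒᵖ

/-- The simplex `σ ∈ X_n` as an object of `Δ(X)`. -/
def simplex (X : SSet.{u}) {n : SimplexCategory} (σ : X.obj (op n)) : SimplicesCat X :=
  op (X.elementsMk (op n) σ)

/-- The morphism `([m], τ) ⟶ ([n], σ)` of `Δ(X)` given by `f : [m] ⟶ [n]` with `f^* σ = τ`. -/
def simplexHom (X : SSet.{u}) {m n : SimplexCategory} (f : m ⟶ n) {τ : X.obj (op m)}
    {σ : X.obj (op n)} (h : X.map f.op σ = τ) : simplex X τ ⟶ simplex X σ :=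
  (CategoryOfElements.homMk (X.elementsMk (op n) σ) (X.elementsMk (op m) τ) f.op h).op

/-- The functor `Δ(f) : Δ(X) ⥤ Δ(Y)` induced by a simplicial map `f : X ⟶ Y`. -/
def simplicesMap {X Y : SSet.{u}} (f : X ⟶ Y) : SimplicesCat X ⥤ SimplicesCat Y :=
  (NatTrans.mapElements f).op

variable (R : Type w) [CommRing R]

/-- A coefficient system for `X` over `R` is a functor `Δ(X) ⥤ R-Mod`. -/
abbrev CoefficientSystem (X : SSet.{u}) := SimplicesCat X ⥤ ModuleCat.{w'} R

variable {R}

/-- The pulled back coefficient system `f^* M`, the composition of `M` with `Δ(f)`. -/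
abbrev CoefficientSystem.pullback {X Y : SSet.{u}} (f : X ⟶ Y)
    (M : CoefficientSystem.{w'} R Y) : CoefficientSystem.{w'} R X :=
  simplicesMap f ⋙ M

variable {X Y : SSet.{u}}

lemma map_simplexHom_apply_id (M : CoefficientSystem.{w'} R X) {n : SimplexCategory}
    (c : ∀ σ : X.obj (op n), M.obj (simplex X σ)) {σ τ : X.obj (op n)}
    (h : X.map (𝟙 n : n ⟶ n).op σ = τ) :
    (M.map (simplexHom X (𝟙 n) h)).hom (c τ) = c σ := by
  have e : σ = τ := by simpa using h
  subst e
  have : simplexHom X (𝟙 n) h = 𝟙 (simplex X σ) := rfl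
  rw [this, M.map_id]
  rfl

lemma map_simplexHom_apply_comp (M : CoefficientSystem.{w'} R X) {k m n : SimplexCategory}
    (f : k ⟶ m) (g : m ⟶ n) (c : ∀ σ : X.obj (op k), M.obj (simplex X σ))
    {σ : X.obj (op n)} {τ : X.obj (op m)} {ρ ρ' : X.obj (op k)}
    (hg : X.map g.op σ = τ) (hf : X.map f.op τ = ρ) (hfg : X.map (f ≫ g).op σ = ρ') :
    (M.map (simplexHom X (f ≫ g) hfg)).hom (c ρ') =
      (M.map (simplexHom X g hg)).hom ((M.map (simplexHom X f hf)).hom (c ρ)) := by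
  have e : ρ' = ρ := by
    rw [← hfg, ← hf, ← hg, op_comp, X.map_comp]
    rfl
  subst e
  have : simplexHom X (f ≫ g) hfg = simplexHom X f hf ≫ simplexHom X g hg := rfl
  rw [this, M.map_comp]
  rfl

/-- The cosimplicial `R`-module `[n] ↦ ∏_{σ ∈ X_n} M(σ)`, where `f : [m] ⟶ [n]` acts by
`(f c)(σ) = f_* (c (f^* σ))`. -/
def cochains (M : CoefficientSystem.{w'} R X) : CosimplicialObject (ModuleCat.{max u w'} R) where
  obj n := ModuleCat.of R (∀ σ : X.obj (op n), M.obj (simplex X σ))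
  map {m n} f := ModuleCat.ofHom
    { toFun := fun c σ ↦ (M.map (simplexHom X f (σ := σ) rfl)).hom (c (X.map f.op σ))
      map_add' := fun c c' ↦ by
        funext σ
        exact map_add _ _ _
      map_smul' := fun r c ↦ by
        funext σ
        exact map_smul _ _ _ }
  map_id n := by
    ext c σ
    exact map_simplexHom_apply_id M c rfl
  map_comp {k m n} f g := by
    ext c σ
    exact map_simplexHom_apply_comp M f g c rfl rfl rfl

/-- The cochain complex `C^*(X; M)`. -/
noncomputable def cochainComplex (M : CoefficientSystem.{w'} R X) :
    CochainComplex (ModuleCat.{max u w'} R) ℕ :=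
  (AlgebraicTopology.alternatingCofaceMapComplex _).obj (cochains M)

/-- The coboundary is `(δ c)(σ) = ∑ i, (-1)^i d^i_* (c (d_i σ))`. -/
lemma cochainComplex_d_apply (M : CoefficientSystem.{w'} R X) (n : ℕ)
    (c : ∀ σ : X _⦋n⦌, M.obj (simplex X σ)) (σ : X _⦋n + 1⦌) :
    ((cochainComplex M).d n (n + 1)).hom c σ =
      ∑ i : Fin (n + 2), (-1 : ℤ) ^ (i : ℕ) •
        (M.map (simplexHom X (SimplexCategory.δ i) (σ := σ) rfl)).hom (c (X.δ i σ)) := by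
  have h : (cochainComplex M).d n (n + 1) =
      ∑ i : Fin (n + 2), (-1 : ℤ) ^ (i : ℕ) • (cochains M).δ i := by
    simp [cochainComplex, AlgebraicTopology.alternatingCofaceMapComplex,
      AlgebraicTopology.AlternatingCofaceMapComplex.obj]
  have key : ∀ {A B : ModuleCat.{max u w'} R} (g : Fin (n + 2) → (A ⟶ B)) (a : A),
      (∑ i : Fin (n + 2), (-1 : ℤ) ^ (i : ℕ) • g i).hom a =
        ∑ i : Fin (n + 2), (-1 : ℤ) ^ (i : ℕ) • (g i).hom a := by
    intro A B g a
    simp [ModuleCat.hom_sum, LinearMap.sum_apply]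
  rw [h]
  refine (congrFun (key (fun i ↦ (cochains M).δ i) c) σ).trans ?_
  exact Finset.sum_apply σ _ _

/-- The cohomology `H^n(X; M)` of the simplicial set `X` with coefficients in `M`. -/
noncomputable def cohomology (M : CoefficientSystem.{w'} R X) (n : ℕ) :
    ModuleCat.{max u w'} R :=
  (cochainComplex M).homology n

/-- The cosimplicial map `(f^* c)(σ) = c (f σ)` induced by a simplicial map `f`. -/
def cochainsMap (f : X ⟶ Y) (M : CoefficientSystem.{w'} R Y) :
    cochains M ⟶ cochains (M.pullback f) where
  app n := ModuleCat.ofHom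
    { toFun := fun c σ ↦ c (f.app (op n) σ)
      map_add' := fun _ _ ↦ rfl
      map_smul' := fun _ _ ↦ rfl }
  naturality {m n} g := by
    ext c
    funext σ
    have aux : ∀ (τ τ' : Y.obj (op m)) (h : Y.map g.op (f.app (op n) σ) = τ)
        (h' : Y.map g.op (f.app (op n) σ) = τ'),
        (M.map (simplexHom Y g h)).hom (c τ) = (M.map (simplexHom Y g h')).hom (c τ') := by
      rintro τ τ' rfl rfl
      rfl
    exact aux _ _ rfl (NatTrans.naturality_apply f g.op σ).symm

/-- The homomorphism `f^* : H^n(Y; M) ⟶ H^n(X; f^* M)` induced by a simplicial map `f`. -/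
noncomputable def cohomologyMap (f : X ⟶ Y) (M : CoefficientSystem.{w'} R Y) (n : ℕ) :
    cohomology M n ⟶ cohomology (M.pullback f) n :=
  HomologicalComplex.homologyMap
    ((AlgebraicTopology.alternatingCofaceMapComplex _).map (cochainsMap f M)) n

/-- The Thomason cohomology `H^n_Th(C; M)` of a small category `C`, where `M` is a coefficient
system for the nerve of `C`. -/
noncomputable abbrev thomasonCohomology {C : Type u} [SmallCategory C]
    (M : CoefficientSystem.{w'} R (nerve C)) (n : ℕ) : ModuleCat.{max u w'} R :=
  cohomology M n

end CoefficientSystems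

section HomotopyColimits

variable {E : Type u} [SmallCategory E]

lemma map_app_comp_apply (F : E ⥤ SSet.{u}) {e₀ e₁ e₂ : E} (α : e₀ ⟶ e₁) (β : e₁ ⟶ e₂)
    (γ : e₀ ⟶ e₂) (h : γ = α ≫ β) {a b c : SimplexCategoryᵒᵖ} (f : a ⟶ b) (g : b ⟶ c)
    (x : (F.obj e₀).obj a) :
    (F.map γ).app c ((F.obj e₀).map (f ≫ g) x) =
      (F.map β).app c ((F.obj e₁).map g ((F.map α).app b ((F.obj e₀).map f x))) := by
  subst h
  rw [← NatTrans.naturality_apply (F.map α) g, F.map_comp, (F.obj e₀).map_comp]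
  rfl

/-- The simplicial replacement `N(E; F)` of `F : E ⥤ sSet`, the bisimplicial set whose
`(p, q)`-simplices are the pairs `(σ, x)` of `σ = (e_0 → ⋯ → e_p)` in the nerve of `E` and
`x ∈ F(e_0)_q`. A pair `(f_h, f_v)` sends `(σ, x)` to
`(f_h^* σ, F(e_0 → e_{f_h(0)}) (f_v^* x))`. -/
def simplicialReplacement (F : E ⥤ SSet.{u}) :
    SimplexCategoryᵒᵖ × SimplexCategoryᵒᵖ ⥤ Type u where
  obj pq := Σ σ : (nerve E).obj pq.1, (F.obj (σ.obj 0)).obj pq.2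
  map {a b} f := ↾fun s ↦
    ⟨(nerve E).map f.1 s.1,
      (F.map (s.1.map (homOfLE (Fin.zero_le (f.1.unop.toOrderHom 0))))).app b.2
        ((F.obj (s.1.obj 0)).map f.2 s.2)⟩
  map_id a := by
    ext ⟨σ, x⟩
    · rfl
    · refine heq_of_eq ?_
      change (F.map (σ.map (𝟙 _))).app a.2 ((F.obj (σ.obj 0)).map (𝟙 a.2) x) = x
      rw [σ.map_id, F.map_id, (F.obj _).map_id]
      rfl
  map_comp {a b c} f g := by
    ext ⟨σ, x⟩
    · rfl
    · exact heq_of_eq (map_app_comp_apply F _ _ _ (σ.map_comp _ _) f.2 g.2 x)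

/-- The homotopy colimit of `F : E ⥤ sSet`: the diagonal of its simplicial replacement. -/
def hocolim (F : E ⥤ SSet.{u}) : SSet.{u} :=
  Functor.diag SimplexCategoryᵒᵖ ⋙ simplicialReplacement F

lemma app_map_app_apply {F : E ⥤ SSet.{u}} {Z : SSet.{u}} (c : F ⟶ (Functor.const E).obj Z)
    {e e' : E} (α : e ⟶ e') {m n : SimplexCategoryᵒᵖ} (f : m ⟶ n) (x : (F.obj e).obj m) :
    (c.app e').app n ((F.map α).app n ((F.obj e).map f x)) =
      Z.map f ((c.app e).app m x) := by
  have h₁ : F.map α ≫ c.app e' = c.app e := (c.naturality α).trans (Category.comp_id _)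
  have h₂ : (c.app e).app n ((F.obj e).map f x) = Z.map f ((c.app e).app m x) :=
    NatTrans.naturality_apply (c.app e) f x
  rw [← h₂, ← h₁]
  rfl

/-- The simplicial map `hocolim F ⟶ Z` induced by simplicial maps `F(e) ⟶ Z` that are natural
in `e`; it sends `(σ, x)` with `σ = (e_0 → ⋯ → e_n)` and `x ∈ F(e_0)_n` to the image of `x`. -/
def hocolimDesc {F : E ⥤ SSet.{u}} {Z : SSet.{u}} (c : F ⟶ (Functor.const E).obj Z) :
    hocolim F ⟶ Z where
  app n := ↾fun s ↦ (c.app (s.1.obj 0)).app n s.2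
  naturality {m n} f := by
    ext ⟨σ, x⟩
    exact app_map_app_apply c _ f x

end HomotopyColimits

section CommaCategories

variable {C D : Type u} [SmallCategory C] [SmallCategory D] (φ : C ⥤ D)

/-- The functor `N(-\φ) : Dᵒᵖ ⥤ sSet`, sending `d` to the nerve of the comma category `d\φ`,
whose objects are the pairs `(c, μ)` with `μ : d ⟶ φ(c)`. -/
def nerveUnder : Dᵒᵖ ⥤ SSet.{u} :=
  StructuredArrow.functor φ ⋙ nerveFunctor.{u, u}

/-- The simplicial maps `N(d\φ) ⟶ NC` induced by the projections `(c, μ) ↦ c`. -/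
def nerveUnderProj : nerveUnder φ ⟶ (Functor.const Dᵒᵖ).obj (nerve C) where
  app d := nerveMap (StructuredArrow.proj d.unop φ)
  naturality _ _ _ := rfl

/-- The simplicial map `υ : hocolim_{Dᵒᵖ} N(-\φ) ⟶ NC`. -/
def upsilon : hocolim (nerveUnder φ) ⟶ nerve C :=
  hocolimDesc (nerveUnderProj φ)

end CommaCategories

end ThomasonCohomology

-- The proof is a dimension shift. Every coefficient system `M` embeds in the coinduced system `I(σ)
-- = ∏_t ∏_{σ ⟶ t} M(t)`. Let `Q` be the quotient. In the long exact sequence of mapping cones,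
-- exactness of the cone of `υ^*` for `I` in degree `n + 1` and for `Q` in degree `n` gives
-- exactness for `M` in degree `n + 1`. Since `Q` is again an arbitrary system, induction on the
-- degree reduces everything to coinduced systems (`coneExactAt_of_coinduced`).
--
-- For coinduced coefficients the cochains, on `NC` as on `Y`, split as a product over the simplices
-- `t` of `NC`. The factor at `t` consists of the cochains, with constant coefficients `M(t)`, on
-- the simplices lying over `t` (`sliceFunction_d`). It therefore suffices that both slices over `t`
-- are acyclic (`coneExactAt_coinduced`).
--
-- Let `t` be a chain `τ` of length `m` in `C`. The slice of `NC` is the nerve of the ordinal `[m]`,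
-- which has a last element. The slice of `Y` is the nerve of the category of triples `(d, i, μ : d
-- ⟶ φ(τ(i)))`, the elements of a functor on `Dᵒᵖ × [m]`. Pushing `i` to `m` gives natural maps `(d,
-- i, μ) ⟶ (d, m, μ') ⟵ (φ(τ(m)), m, id)`, so the identity is joined to a constant functor and the
-- nerve is acyclic.

universe v v'

namespace ThomasonCohomology

/-! ### Natural transformations as homotopies of nerves. -/

section NerveHomotopy

open MonoidalCategory

variable {E E' : Type u} [SmallCategory E] [SmallCategory E']

/-- The map `N(E) × Δ[1] ⟶ N(E')` given by a natural transformation. -/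
noncomputable def nerveProdMap {F G : E ⥤ E'} (θ : F ⟶ G) :
    nerve E ⊗ (Δ[1] : SSet.{u}) ⟶ nerve E' where
  app n := ↾fun s ↦ Functor.prod'
      (SimplexCategory.toCat.map (SSet.stdSimplex.objEquiv s.2)).toFunctor
      (show ComposableArrows E n.unop.len from s.1) ⋙
    Functor.uncurry.obj (ComposableArrows.mk₁ θ)
  naturality _ _ _ := rfl

/-- A natural transformation induces a homotopy between the maps of nerves. -/
noncomputable def nerveMapHomotopy {F G : E ⥤ E'} (θ : F ⟶ G) :
    SSet.Homotopy (nerveMap F) (nerveMap G) where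
  h := nerveProdMap θ
  h₀ := by
    ext n x
    refine CategoryTheory.Functor.ext (F := _) (G := x ⋙ F) (fun _ ↦ rfl) (fun i j f ↦ ?_)
    change 𝟙 (F.obj (x.obj i)) ≫ F.map (x.map f) = 𝟙 _ ≫ _ ≫ 𝟙 _
    simp
    rfl
  h₁ := by
    ext n x
    refine CategoryTheory.Functor.ext (F := _) (G := x ⋙ G) (fun _ ↦ rfl) (fun i j f ↦ ?_)
    change 𝟙 (G.obj (x.obj i)) ≫ G.map (x.map f) = 𝟙 _ ≫ _ ≫ 𝟙 _
    simp
    rfl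
  rel := by
    ext n ⟨⟨_, h⟩, _⟩
    exact h.elim

end NerveHomotopy

/-! ### Acyclicity with constant coefficients. -/

section Acyclicity

/-- The alternating sum of coface maps on functions. -/
def altCoface {Z : ℕ → Type*} (d : ∀ n, Fin (n + 2) → Z (n + 1) → Z n)
    {A : Type*} [AddCommGroup A] (n : ℕ) (c : Z n → A) : Z (n + 1) → A :=
  fun z ↦ ∑ i : Fin (n + 2), (-1 : ℤ) ^ (i : ℕ) • c (d n i z)

/-- Acyclicity of the alternating coface complex with values in `A`: there is a point, the
`0`-cocycles are constant, and the cocycles of positive degree are coboundaries. -/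
structure FaceAcyclic {Z : ℕ → Type*} (d : ∀ n, Fin (n + 2) → Z (n + 1) → Z n)
    (A : Type*) [AddCommGroup A] : Prop where
  nonempty : Nonempty (Z 0)
  zero (c : Z 0 → A) (hc : altCoface d 0 c = 0) : ∃ k : A, ∀ z, c z = k
  succ (n : ℕ) (c : Z (n + 1) → A) (hc : altCoface d (n + 1) c = 0) :
    ∃ b : Z n → A, altCoface d n b = c

lemma FaceAcyclic.of_equiv {Z Z' : ℕ → Type*} {d : ∀ n, Fin (n + 2) → Z (n + 1) → Z n}
    {d' : ∀ n, Fin (n + 2) → Z' (n + 1) → Z' n} {A : Type*} [AddCommGroup A]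
    (h : FaceAcyclic d A) (e : ∀ n, Z n ≃ Z' n)
    (he : ∀ n i z, e n (d n i z) = d' n i (e (n + 1) z)) :
    FaceAcyclic d' A := by
  have key (n) (c : Z' n → A) : altCoface d n (c ∘ e n) = altCoface d' n c ∘ e (n + 1) := by
    funext z
    simp [altCoface, he]
  refine ⟨h.nonempty.map (e 0), fun c hc ↦ ?_, fun n c hc ↦ ?_⟩
  · obtain ⟨k, hk⟩ := h.zero (c ∘ e 0) (by rw [key, hc]; rfl)
    exact ⟨k, fun z ↦ by simpa using hk ((e 0).symm z)⟩
  · obtain ⟨b, hb⟩ := h.succ n (c ∘ e _) (by rw [key, hc]; rfl)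
    refine ⟨b ∘ (e n).symm, ?_⟩
    have := key n (b ∘ (e n).symm)
    have e1 : (b ∘ (e n).symm) ∘ e n = b := by funext z; simp
    rw [e1, hb] at this
    funext z
    simpa using (congrFun this ((e _).symm z)).symm

/-- The contravariant functor of `A`-valued functions. -/
def functionsOp (A : Type w) [AddCommGroup A] : Type u ⥤ (ModuleCat.{max u w} ℤ)ᵒᵖ where
  obj S := op (ModuleCat.of ℤ (S → A))
  map f := (ModuleCat.ofHom (LinearMap.funLeft ℤ A f)).op

/-- Homotopic simplicial maps agree on cocycles, up to coboundaries. -/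
lemma cochain_homotopy {X Y : SSet.{u}} {f g : X ⟶ Y} (H : SimplicialObject.Homotopy f g)
    (A : Type w) [AddCommGroup A] :
    (∀ c : Y _⦋0⦌ → A, altCoface (Z := fun n ↦ Y _⦋n⦌) (fun _ i ↦ Y.δ i) 0 c = 0 →
      ∀ x, c (f.app _ x) = c (g.app _ x)) ∧
    ∀ (n : ℕ) (c : Y _⦋n + 1⦌ → A),
      altCoface (Z := fun n ↦ Y _⦋n⦌) (fun _ i ↦ Y.δ i) (n + 1) c = 0 →
      ∃ b, altCoface (Z := fun n ↦ X _⦋n⦌) (fun _ i ↦ X.δ i) n b =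
        fun x ↦ c (f.app _ x) - c (g.app _ x) := by
  let h := (H.whiskerRight (functionsOp.{w} A)).toChainHomotopy
  have hd (Z : SSet.{u}) (n) (c : Z _⦋n⦌ → A) : (((AlgebraicTopology.alternatingFaceMapComplex _).obj
      (((SimplicialObject.whiskering _ _).obj (functionsOp.{w} A)).obj Z)).d (n+1) n).unop.hom c =
        altCoface (Z := fun n ↦ Z _⦋n⦌) (fun _ i ↦ Z.δ i) n c := by
    have key {k : ℕ} {P Q : (ModuleCat.{max u w} ℤ)ᵒᵖ} (φ : Fin k → (P ⟶ Q)) (a : Q.unop) :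
        (∑ i : Fin k, (-1 : ℤ) ^ (i : ℕ) • φ i).unop.hom a =
          ∑ i : Fin k, (-1 : ℤ) ^ (i : ℕ) • (φ i).unop.hom a := by
      simp [ModuleCat.hom_sum, LinearMap.sum_apply]
    rw [AlgebraicTopology.alternatingFaceMapComplex_obj_d]
    refine (key (P := (functionsOp A).obj (Z _⦋n + 1⦌)) (Q := (functionsOp A).obj (Z _⦋n⦌))
      (fun i ↦ (functionsOp A).map (Z.δ i)) c).trans ?_
    funext z
    exact Finset.sum_apply z _ _
  -- A chain homotopy in the opposite category raises degree; read backwards on functions, it lowers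
  -- the degree of cochains.
  let K (n : ℕ) : (Y _⦋n + 1⦌ → A) →ₗ[ℤ] (X _⦋n⦌ → A) := (h.hom n (n + 1)).unop.hom
  constructor
  · intro c hc x
    have e := h.comm 0
    rw [prevD_eq (j' := 1) (w := by simp), dNext_eq_zero _ _ (by simp), zero_add] at e
    have e' : c ∘ f.app _ = K 0 (altCoface (Z := fun n ↦ Y _⦋n⦌)
        (fun n i ↦ Y.δ i) 0 c) + c ∘ g.app _ := by
      rw [← hd]
      exact congrArg (fun t ↦ t.unop.hom c) e
    rw [hc, map_zero, zero_add] at e'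
    exact congrFun e' x
  · intro n c hc
    have e := h.comm (n + 1)
    rw [dNext_eq (i' := n) (w := by simp), prevD_eq (j' := n + 2) (w := by simp)] at e
    refine ⟨K n c, ?_⟩
    have e' : c ∘ f.app _ = altCoface (Z := fun n ↦ X _⦋n⦌) (fun _ i ↦ X.δ i) n
          (K n c) +
        K (n + 1) (altCoface (Z := fun n ↦ Y _⦋n⦌)
          (fun n i ↦ Y.δ i) (n + 1) c) + c ∘ g.app _ := by
      rw [← hd, ← hd]
      exact congrArg (fun t ↦ t.unop.hom c) e
    rw [hc, map_zero, add_zero] at e'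
    funext x
    exact eq_sub_of_add_eq (congrFun e' x).symm

/-- The nerve of `E` is acyclic if the identity of `E` is joined to a constant functor by natural
transformations `𝟭 ⟶ G` and `const ⟶ G`. -/
lemma faceAcyclic_nerve {E : Type u} [SmallCategory E] {e₀ : E} {G : E ⥤ E}
    (θ : 𝟭 E ⟶ G) (θ' : (Functor.const E).obj e₀ ⟶ G) (A : Type w) [AddCommGroup A] :
    FaceAcyclic (Z := fun n ↦ (nerve E) _⦋n⦌) (fun _ i ↦ (nerve E).δ i) A := by
  have H := cochain_homotopy (nerveMapHomotopy θ).toSimplicialObjectHomotopy A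
  have H' := cochain_homotopy (nerveMapHomotopy θ').toSimplicialObjectHomotopy A
  let pt (n : ℕ) : (nerve E) _⦋n⦌ := (Functor.const _).obj e₀
  refine ⟨⟨pt 0⟩, fun c hc ↦ ⟨c (pt 0), fun z ↦ ?_⟩, fun n c hc ↦ ?_⟩
  · exact (H.1 c hc z).trans (H'.1 c hc z).symm
  · obtain ⟨b, hb⟩ := H.2 n c hc
    obtain ⟨b', hb'⟩ := H'.2 n c hc
    -- A constant cochain of degree `n` is sent by the coboundary to the same constant if `n` is odd
    -- and to `0` if `n` is even. In the even case the cocycle condition at a constant simplex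
    -- forces `c (pt (n + 1)) = 0`.
    have hpt : ∑ i : Fin (n + 3), (-1 : ℤ) ^ (i : ℕ) • c (pt (n + 1)) = 0 :=
      congrFun hc (pt (n + 2))
    rw [← Finset.sum_smul, Fin.sum_neg_one_pow] at hpt
    -- `b` bounds `c - G^* c` and `b'` bounds `const^* c - G^* c`, so `b - b'` bounds `c` minus a
    -- constant; the last term bounds that constant.
    refine ⟨fun z ↦ b z - b' z + c (pt (n + 1)), ?_⟩
    funext z
    have h1 := congrFun hb z
    have h2 := congrFun hb' z
    have h3 : ∑ i : Fin (n + 2), (-1 : ℤ) ^ (i : ℕ) • c (pt (n + 1)) = c (pt (n + 1)) := by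
      rw [← Finset.sum_smul, Fin.sum_neg_one_pow]
      split_ifs at hpt ⊢ with h4 h5 <;> simp_all [Nat.even_add, parity_simps]
    simp only [altCoface, smul_add, smul_sub, Finset.sum_add_distrib,
      Finset.sum_sub_distrib] at h1 h2 ⊢
    rw [h1, h2, h3]
    change c z - _ - (c (pt (n + 1)) - _) + _ = _
    abel

end Acyclicity

/-! ### Mapping cones and isomorphisms on cohomology. -/

section Cone

variable {R : Type w} [CommRing R]

/-- Exactness in degree `n` of the mapping cone of a morphism of cochain complexes, where the
cone has `K.X n × L.X (n - 1)` in degree `n`. -/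
def ConeExactAt {K L : CochainComplex (ModuleCat.{v} R) ℕ} (f : K ⟶ L) (n : ℕ) : Prop :=
  match n with
  | 0 => ∀ c : K.X 0, K.d 0 1 c = 0 → f.f 0 c = 0 → c = 0
  | 1 => ∀ (c : K.X 1) (b : L.X 0), K.d 1 2 c = 0 → f.f 1 c = L.d 0 1 b →
      ∃ a : K.X 0, K.d 0 1 a = c ∧ f.f 0 a = b
  | n + 2 => ∀ (c : K.X (n + 2)) (b : L.X (n + 1)), K.d (n + 2) (n + 3) c = 0 →
      f.f (n + 2) c = L.d (n + 1) (n + 2) b →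
      ∃ (a : K.X (n + 1)) (e : L.X n), K.d (n + 1) (n + 2) a = c ∧
        f.f (n + 1) a = b + L.d n (n + 1) e

variable {K L : CochainComplex (ModuleCat.{v} R) ℕ}

lemma exists_homologyπ_eq (K : CochainComplex (ModuleCat.{v} R) ℕ) (n : ℕ) (x : K.homology n) :
    ∃ z : K.cycles n, K.homologyπ n z = x :=
  (ModuleCat.epi_iff_surjective (K.homologyπ n)).mp inferInstance x

lemma exists_iCycles_eq (K : CochainComplex (ModuleCat.{v} R) ℕ) (n : ℕ) (c : K.X n)
    (hc : K.d n (n + 1) c = 0) : ∃ z : K.cycles n, K.iCycles n z = c := by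
  have := (ShortComplex.moduleCat_exact_iff _).1
    (ShortComplex.exact_of_f_is_kernel (ShortComplex.mk _ _ (K.iCycles_d n (n + 1)))
      (K.cyclesIsKernel n (n + 1) (by simp)))
  exact this c hc

lemma d_iCycles_apply (K : CochainComplex (ModuleCat.{v} R) ℕ) (n : ℕ) (z : K.cycles n) :
    K.d n (n + 1) (K.iCycles n z) = 0 := by
  have := K.iCycles_d n (n + 1)
  exact congrArg (fun t ↦ t.hom z) this

lemma iCycles_injective (K : CochainComplex (ModuleCat.{v} R) ℕ) (n : ℕ) :
    Function.Injective (K.iCycles n) :=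
  (ModuleCat.mono_iff_injective (K.iCycles n)).mp inferInstance

lemma homologyπ_eq_zero_iff (K : CochainComplex (ModuleCat.{v} R) ℕ) (i n : ℕ)
    (hi : (ComplexShape.up ℕ).prev n = i) (z : K.cycles n) :
    K.homologyπ n z = 0 ↔ ∃ b : K.X i, K.d i n b = K.iCycles n z := by
  have h := (ShortComplex.moduleCat_exact_iff _).1
    (ShortComplex.exact_of_g_is_cokernel
      (ShortComplex.mk _ _ (K.toCycles_comp_homologyπ i n)) (K.homologyIsCokernel i n hi))
  constructor
  · intro hz
    obtain ⟨b, hb⟩ := h z hz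
    refine ⟨b, ?_⟩
    rw [← hb]
    exact (congrArg (fun t ↦ t.hom b) (K.toCycles_i i n)).symm
  · rintro ⟨b, hb⟩
    have : K.toCycles i n b = z := by
      apply iCycles_injective
      rw [← hb]
      exact congrArg (fun t ↦ t.hom b) (K.toCycles_i i n)
    rw [← this]
    exact congrArg (fun t ↦ t.hom b) (K.toCycles_comp_homologyπ i n)

/-- Injectivity comes from degree `n`: if `f z = d b`, then `(z, b)` is a cocycle of the cone.
Surjectivity comes from degree `n + 1`, applied to the cone cocycle `(0, z)`. -/
lemma ConeExactAt.isIso_homologyMap {f : K ⟶ L} {n : ℕ} (h : ConeExactAt f n)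
    (h' : ConeExactAt f (n + 1)) : IsIso (HomologicalComplex.homologyMap f n) := by
  have hπ (z : K.cycles n) : HomologicalComplex.homologyMap f n (K.homologyπ n z) =
      L.homologyπ n (HomologicalComplex.cyclesMap f n z) :=
    congrArg (fun t ↦ t.hom z) (HomologicalComplex.homologyπ_naturality f n)
  have hi (z : K.cycles n) : L.iCycles n (HomologicalComplex.cyclesMap f n z) =
      f.f n (K.iCycles n z) :=
    congrArg (fun t ↦ t.hom z) (HomologicalComplex.cyclesMap_i f n)
  rw [ConcreteCategory.isIso_iff_bijective]
  constructor
  · rw [injective_iff_map_eq_zero]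
    intro x hx
    obtain ⟨z, rfl⟩ := exists_homologyπ_eq K n x
    rw [hπ] at hx
    match n with
    | 0 =>
      obtain ⟨b, hb⟩ := (homologyπ_eq_zero_iff L 0 0 (by simp) _).1 hx
      -- By convention the predecessor of degree `0` is `0` itself, with zero differential.
      have : L.d 0 0 = 0 := L.shape _ _ (by simp)
      rw [this, hi] at hb
      have h0 : K.iCycles 0 z = 0 := h _ (d_iCycles_apply K 0 z) hb.symm
      have : z = 0 := iCycles_injective K 0 (h0.trans (map_zero _).symm)
      rw [this, map_zero]
    | 1 =>
      obtain ⟨b, hb⟩ := (homologyπ_eq_zero_iff L 0 1 (by simp) _).1 hx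
      rw [hi] at hb
      obtain ⟨a, ha, -⟩ := h _ b (d_iCycles_apply K 1 z) hb.symm
      exact (homologyπ_eq_zero_iff K 0 1 (by simp) _).2 ⟨a, ha⟩
    | n + 2 =>
      obtain ⟨b, hb⟩ := (homologyπ_eq_zero_iff L (n + 1) (n + 2) (by simp) _).1 hx
      rw [hi] at hb
      obtain ⟨a, _, ha, -⟩ := h _ b (d_iCycles_apply K (n + 2) z) hb.symm
      exact (homologyπ_eq_zero_iff K (n + 1) (n + 2) (by simp) _).2 ⟨a, ha⟩
  · intro y
    obtain ⟨z, rfl⟩ := exists_homologyπ_eq L n y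
    match n with
    | 0 =>
      obtain ⟨a, ha, ha'⟩ := h' 0 (L.iCycles 0 z) (map_zero _)
        ((map_zero _).trans (d_iCycles_apply L 0 z).symm)
      obtain ⟨t, rfl⟩ := exists_iCycles_eq K 0 a ha
      refine ⟨K.homologyπ 0 t, ?_⟩
      rw [hπ, iCycles_injective L 0 ((hi t).trans ha')]
    | n + 1 =>
      obtain ⟨a, e, ha, ha'⟩ := h' 0 (L.iCycles (n + 1) z) (map_zero _)
        ((map_zero _).trans (d_iCycles_apply L (n + 1) z).symm)
      obtain ⟨t, rfl⟩ := exists_iCycles_eq K (n + 1) a ha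
      refine ⟨K.homologyπ (n + 1) t, ?_⟩
      rw [hπ, ← sub_eq_zero, ← map_sub]
      refine (homologyπ_eq_zero_iff L n (n + 1) (by simp) _).2 ⟨e, ?_⟩
      rw [map_sub, hi, ha', add_sub_cancel_left]

end Cone

/-! ### Dimension shifting along short exact sequences of complexes. -/

section DimensionShift

variable {R : Type w} [CommRing R]

/-- A degreewise short exact sequence of cochain complexes of modules; the first complex may live
in a different universe. -/
structure CochainShortExact (K₁ : CochainComplex (ModuleCat.{v} R) ℕ)
    (K₂ K₃ : CochainComplex (ModuleCat.{v'} R) ℕ) where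
  i (n : ℕ) : K₁.X n →ₗ[R] K₂.X n
  p (n : ℕ) : K₂.X n →ₗ[R] K₃.X n
  d_i (n : ℕ) (c : K₁.X n) : K₂.d n (n + 1) (i n c) = i (n + 1) (K₁.d n (n + 1) c)
  d_p (n : ℕ) (c : K₂.X n) : K₃.d n (n + 1) (p n c) = p (n + 1) (K₂.d n (n + 1) c)
  i_injective (n : ℕ) : Function.Injective (i n)
  p_surjective (n : ℕ) : Function.Surjective (p n)
  p_i (n : ℕ) (c : K₁.X n) : p n (i n c) = 0
  exact (n : ℕ) (c : K₂.X n) (hc : p n c = 0) : ∃ c', i n c' = c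

lemma d_d_apply (K : CochainComplex (ModuleCat.{v} R) ℕ) (n : ℕ) (c : K.X n) :
    K.d (n + 1) (n + 2) (K.d n (n + 1) c) = 0 :=
  congrArg (fun t ↦ t.hom c) (K.d_comp_d n (n + 1) (n + 2))

variable {K₁ L₁ : CochainComplex (ModuleCat.{v} R) ℕ}
  {K₂ K₃ L₂ L₃ : CochainComplex (ModuleCat.{v'} R) ℕ}
  {f₁ : K₁ ⟶ L₁} {f₂ : K₂ ⟶ L₂} {f₃ : K₃ ⟶ L₃}

lemma hom_d_apply (f₁ : K₁ ⟶ L₁) (n : ℕ) (c : K₁.X n) :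
    f₁.f (n + 1) (K₁.d n (n + 1) c) = L₁.d n (n + 1) (f₁.f n c) :=
  (congrArg (fun t ↦ t.hom c) (f₁.comm n (n + 1))).symm

lemma ConeExactAt.zero_of_shortExact (S : CochainShortExact K₁ K₂ K₃)
    (T : CochainShortExact L₁ L₂ L₃)
    (hi : ∀ n c, f₂.f n (S.i n c) = T.i n (f₁.f n c))
    (h₂ : ConeExactAt f₂ 0) : ConeExactAt f₁ 0 := by
  intro c hc hc'
  apply S.i_injective
  rw [map_zero]
  exact h₂ _ (by rw [S.d_i, hc, map_zero]) (by rw [hi, hc', map_zero])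

/-- This is the piece `H^n(cone f₃) → H^{n+1}(cone f₁) → H^{n+1}(cone f₂)` of the long exact
sequence, chased on elements. Its three cases follow those of `ConeExactAt`. -/
lemma ConeExactAt.succ_of_shortExact (S : CochainShortExact K₁ K₂ K₃)
    (T : CochainShortExact L₁ L₂ L₃)
    (hi : ∀ n c, f₂.f n (S.i n c) = T.i n (f₁.f n c))
    (hp : ∀ n c, f₃.f n (S.p n c) = T.p n (f₂.f n c)) {n : ℕ}
    (h₂ : ConeExactAt f₂ (n + 1)) (h₃ : ConeExactAt f₃ n) : ConeExactAt f₁ (n + 1) := by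
  match n with
  | 0 =>
    intro c b hc hcb
    obtain ⟨a, ha, hab⟩ := h₂ (S.i 1 c) (T.i 0 b) (by rw [S.d_i, hc, map_zero])
      (by rw [hi, hcb, T.d_i])
    obtain ⟨a', rfl⟩ := S.exact 0 a (h₃ _ (by rw [S.d_p, ha, S.p_i]) (by rw [hp, hab, T.p_i]))
    exact ⟨a', S.i_injective _ (by rw [← S.d_i, ha]), T.i_injective _ (by rw [← hi, hab])⟩
  | 1 =>
    intro c b hc hcb
    obtain ⟨a, e, ha, hab⟩ := h₂ (S.i 2 c) (T.i 1 b) (by rw [S.d_i, hc, map_zero])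
      (by rw [hi, hcb, T.d_i])
    obtain ⟨g, hg, hg'⟩ := h₃ (S.p 1 a) (T.p 0 e) (by rw [S.d_p, ha, S.p_i])
      (by rw [hp, hab, map_add, T.p_i, zero_add, T.d_p])
    obtain ⟨g, rfl⟩ := S.p_surjective _ g
    obtain ⟨a', ha'⟩ := S.exact 1 (a - K₂.d 0 1 g) (by rw [map_sub, ← S.d_p, hg, sub_self])
    obtain ⟨e', he'⟩ := T.exact 0 (e - f₂.f 0 g) (by rw [map_sub, ← hp, hg', sub_self])
    refine ⟨a', e', S.i_injective _ ?_, T.i_injective _ ?_⟩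
    · rw [← S.d_i, ha', map_sub, d_d_apply, ha, sub_zero]
    · rw [← hi, ha', map_sub, hom_d_apply, hab, map_add, ← T.d_i, he', map_sub, add_sub_assoc]
  | n + 2 =>
    intro c b hc hcb
    obtain ⟨a, e, ha, hab⟩ := h₂ (S.i _ c) (T.i _ b) (by rw [S.d_i, hc, map_zero])
      (by rw [hi, hcb, T.d_i])
    -- The image of `(a, e)` is a cocycle of the cone of `f₃`. Subtracting from `(a, e)` the
    -- coboundary `(d g, f₂ g - d z)` of a lifted primitive moves the pair into the image of the
    -- first cone.
    obtain ⟨g, z, hg, hg'⟩ := h₃ (S.p _ a) (T.p _ e) (by rw [S.d_p, ha, S.p_i])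
      (by rw [hp, hab, map_add, T.p_i, zero_add, T.d_p])
    obtain ⟨g, rfl⟩ := S.p_surjective _ g
    obtain ⟨z, rfl⟩ := T.p_surjective _ z
    obtain ⟨a', ha'⟩ := S.exact _ (a - K₂.d _ _ g) (by rw [map_sub, ← S.d_p, hg, sub_self])
    obtain ⟨e', he'⟩ := T.exact _ (e - f₂.f _ g + L₂.d _ _ z)
      (by rw [map_add, map_sub, ← hp, hg', ← T.d_p]; abel)
    refine ⟨a', e', S.i_injective _ ?_, T.i_injective _ ?_⟩
    · rw [← S.d_i, ha', map_sub, d_d_apply, ha, sub_zero]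
    · rw [← hi, ha', map_sub, hom_d_apply, hab, map_add, ← T.d_i, he', map_add, map_sub, d_d_apply,
        add_zero, add_sub_assoc]

end DimensionShift

/-! ### Coinduced coefficients and the reduction to them. -/

section Coinduced

variable {R : Type w} [CommRing R] {J : Type u} [Category.{0} J] (M : J ⥤ ModuleCat.{w'} R)

/-- The functor `σ ↦ ∏_t ∏_{σ ⟶ t} M(t)`. -/
def coinduced : J ⥤ ModuleCat.{max u w'} R where
  obj σ := ModuleCat.of R (∀ t : J, (σ ⟶ t) → M.obj t)
  map g := ModuleCat.ofHom
    { toFun := fun c t f ↦ c t (g ≫ f)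
      map_add' := fun _ _ ↦ rfl
      map_smul' := fun _ _ ↦ rfl }
  map_id σ := by
    ext c t f
    exact congrArg (c t) (Category.id_comp f)
  map_comp g h := by
    ext c t f
    exact congrArg (c t) (Category.assoc g h f)

/-- The embedding of `M` in the coinduced functor. -/
def toCoinduced (σ : J) : M.obj σ →ₗ[R] (coinduced M).obj σ where
  toFun x t f := (M.map f).hom x
  map_add' x y := by
    funext t f
    exact map_add _ _ _
  map_smul' r x := by
    funext t f
    exact map_smul _ _ _

lemma toCoinduced_injective (σ : J) : Function.Injective (toCoinduced M σ) := by
  intro x y h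
  have : (M.map (𝟙 σ)).hom x = (M.map (𝟙 σ)).hom y := congrFun (congrFun h σ) (𝟙 σ)
  simpa using this

lemma toCoinduced_naturality {σ σ' : J} (g : σ ⟶ σ') (x : M.obj σ) :
    toCoinduced M σ' ((M.map g).hom x) = ((coinduced M).map g).hom (toCoinduced M σ x) := by
  funext t f
  change (M.map f).hom ((M.map g).hom x) = (M.map (g ≫ f)).hom x
  rw [M.map_comp]
  rfl

/-- The cokernel of the embedding of `M` in the coinduced functor. -/
def coinducedQuotient : J ⥤ ModuleCat.{max u w'} R where
  obj σ := ModuleCat.of R ((coinduced M).obj σ ⧸ LinearMap.range (toCoinduced M σ))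
  map g := ModuleCat.ofHom (Submodule.mapQ _ _ ((coinduced M).map g).hom (by
    rintro _ ⟨x, rfl⟩
    exact ⟨_, toCoinduced_naturality M g x⟩))
  map_id σ := by
    ext x
    exact congrArg (Submodule.mkQ _) (congrArg (fun t ↦ t.hom x) ((coinduced M).map_id σ))
  map_comp g h := by
    ext x
    exact congrArg (Submodule.mkQ _) (congrArg (fun t ↦ t.hom x) ((coinduced M).map_comp g h))

/-- The projection of the coinduced functor to the quotient by `M`. -/
def toCoinducedQuotient (σ : J) : (coinduced M).obj σ →ₗ[R] (coinducedQuotient M).obj σ :=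
  Submodule.mkQ _

lemma toCoinducedQuotient_naturality {σ σ' : J} (g : σ ⟶ σ') (x : (coinduced M).obj σ) :
    toCoinducedQuotient M σ' (((coinduced M).map g).hom x) =
      ((coinducedQuotient M).map g).hom (toCoinducedQuotient M σ x) :=
  rfl

end Coinduced

section Cochains

variable {R : Type w} [CommRing R] {X Y : SSet.{u}}

/-- The map of cochains induced by linear maps of coefficients. -/
noncomputable def cochainsCoeffMap {M : CoefficientSystem.{v} R X} {N : CoefficientSystem.{v'} R X}
    (α : ∀ σ, M.obj σ →ₗ[R] N.obj σ) (n : ℕ) :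
    (cochainComplex M).X n →ₗ[R] (cochainComplex N).X n :=
  LinearMap.pi (R := R) (φ := fun σ : X _⦋n⦌ ↦ N.obj (simplex X σ)) fun σ ↦
    α (simplex X σ) ∘ₗ LinearMap.proj (R := R) (φ := fun σ : X _⦋n⦌ ↦ M.obj (simplex X σ)) σ

lemma d_cochainsCoeffMap {M : CoefficientSystem.{v} R X} {N : CoefficientSystem.{v'} R X}
    (α : ∀ σ, M.obj σ →ₗ[R] N.obj σ)
    (hα : ∀ {σ σ'} (g : σ ⟶ σ') (x : M.obj σ), α σ' ((M.map g).hom x) = (N.map g).hom (α σ x))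
    (n : ℕ) (c : (cochainComplex M).X n) :
    (cochainComplex N).d n (n + 1) (cochainsCoeffMap α n c) =
      cochainsCoeffMap α (n + 1) ((cochainComplex M).d n (n + 1) c) := by
  funext σ
  refine (cochainComplex_d_apply N n _ σ).trans ?_
  refine Eq.trans ?_ (congrArg (α (simplex X σ)) (cochainComplex_d_apply M n c σ)).symm
  rw [map_sum]
  refine Finset.sum_congr rfl fun i _ ↦ ?_
  rw [map_zsmul]
  exact congrArg _ (hα _ _).symm

/-- The short exact sequence of cochain complexes given by a pointwise short exact sequence of
coefficients. -/
noncomputable def cochainShortExact {M : CoefficientSystem.{v} R X} {I Q : CoefficientSystem.{v'} R X}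
    (α : ∀ σ, M.obj σ →ₗ[R] I.obj σ) (β : ∀ σ, I.obj σ →ₗ[R] Q.obj σ)
    (hα : ∀ {σ σ'} (g : σ ⟶ σ') (x : M.obj σ), α σ' ((M.map g).hom x) = (I.map g).hom (α σ x))
    (hβ : ∀ {σ σ'} (g : σ ⟶ σ') (x : I.obj σ), β σ' ((I.map g).hom x) = (Q.map g).hom (β σ x))
    (hi : ∀ σ, Function.Injective (α σ)) (hs : ∀ σ, Function.Surjective (β σ))
    (he : ∀ σ, Function.Exact (α σ) (β σ)) :
    CochainShortExact (cochainComplex M) (cochainComplex I) (cochainComplex Q) where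
  i := cochainsCoeffMap α
  p := cochainsCoeffMap β
  d_i n c := d_cochainsCoeffMap α hα n c
  d_p n c := d_cochainsCoeffMap β hβ n c
  i_injective n c c' h := by
    funext σ
    exact hi _ (congrFun h σ)
  p_surjective n c := by
    choose b hb using fun σ : X _⦋n⦌ ↦ hs (simplex X σ) (c σ)
    exact ⟨b, funext hb⟩
  p_i n c := by
    funext σ
    exact (he _ _).2 ⟨_, rfl⟩
  exact n c hc := by
    choose b hb using fun σ : X _⦋n⦌ ↦ (he (simplex X σ) (c σ)).1 (congrFun hc σ)
    exact ⟨b, funext hb⟩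

/-- The morphism of cochain complexes induced by a simplicial map. -/
noncomputable def cochainComplexMap (f : Y ⟶ X) (M : CoefficientSystem.{w'} R X) :
    cochainComplex M ⟶ cochainComplex (M.pullback f) :=
  (AlgebraicTopology.alternatingCofaceMapComplex _).map (cochainsMap f M)

/-- The sequence `0 → C(X; M) → C(X; I) → C(X; I/M) → 0`, pulled back to `Y`, where `I` is the
coinduced coefficient system. -/
noncomputable def pullbackCoinducedShortExact (f : Y ⟶ X) (M : CoefficientSystem.{w'} R X) :
    CochainShortExact (cochainComplex (M.pullback f)) (cochainComplex (simplicesMap f ⋙ coinduced M))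
      (cochainComplex (simplicesMap f ⋙ coinducedQuotient M)) :=
  cochainShortExact (fun σ ↦ toCoinduced M ((simplicesMap f).obj σ))
    (fun σ ↦ toCoinducedQuotient M ((simplicesMap f).obj σ))
    (fun g x ↦ toCoinduced_naturality M ((simplicesMap f).map g) x) (fun _ _ ↦ rfl)
    (fun _ ↦ toCoinduced_injective M _) (fun _ ↦ Submodule.mkQ_surjective _)
    (fun _ ↦ LinearMap.exact_map_mkQ_range _)

/-- The sequence `0 → C(X; M) → C(X; I) → C(X; I/M) → 0`, where `I` is the coinduced
coefficient system. -/
noncomputable def coinducedShortExact (M : CoefficientSystem.{w'} R X) :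
    CochainShortExact (cochainComplex M) (cochainComplex (coinduced M))
      (cochainComplex (coinducedQuotient M)) :=
  cochainShortExact (toCoinduced M) (toCoinducedQuotient M)
    (toCoinduced_naturality M) (fun _ _ ↦ rfl)
    (toCoinduced_injective M) (fun _ ↦ Submodule.mkQ_surjective _)
    (fun _ ↦ LinearMap.exact_map_mkQ_range _)

lemma coneExactAt_zero_of_coinduced (f : Y ⟶ X) (M : CoefficientSystem.{w'} R X)
    (h : ConeExactAt (cochainComplexMap f (coinduced M)) 0) :
    ConeExactAt (cochainComplexMap f M) 0 :=
  h.zero_of_shortExact (coinducedShortExact M) (pullbackCoinducedShortExact f M) (fun _ _ ↦ rfl)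

lemma coneExactAt_succ_of_coinduced (f : Y ⟶ X) (M : CoefficientSystem.{w'} R X) (n : ℕ)
    (h : ConeExactAt (cochainComplexMap f (coinduced M)) (n + 1))
    (h' : ConeExactAt (cochainComplexMap f (coinducedQuotient M)) n) :
    ConeExactAt (cochainComplexMap f M) (n + 1) :=
  h.succ_of_shortExact (coinducedShortExact M) (pullbackCoinducedShortExact f M) (fun _ _ ↦ rfl)
    (fun _ _ ↦ rfl) h'

/-- The coinduced system and its quotient live in universe `max u w'`, which is stable under the
construction. The induction therefore runs there, and one further shift brings the result down to
`w'`. -/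
lemma coneExactAt_of_coinduced (f : Y ⟶ X)
    (h : ∀ (M : CoefficientSystem.{w'} R X) (n : ℕ),
      ConeExactAt (cochainComplexMap f (coinduced M)) n)
    (h' : ∀ (M : CoefficientSystem.{max u w'} R X) (n : ℕ),
      ConeExactAt (cochainComplexMap f (coinduced M)) n)
    (M : CoefficientSystem.{w'} R X) (n : ℕ) :
    ConeExactAt (cochainComplexMap f M) n := by
  have key (n : ℕ) : ∀ M : CoefficientSystem.{max u w'} R X,
      ConeExactAt (cochainComplexMap f M) n := by
    induction n with
    | zero => exact fun M ↦ coneExactAt_zero_of_coinduced f M (h' M 0)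
    | succ n hn => exact fun M ↦ coneExactAt_succ_of_coinduced f M n (h' M _) (hn _)
  cases n with
  | zero => exact coneExactAt_zero_of_coinduced f M (h M 0)
  | succ n => exact coneExactAt_succ_of_coinduced f M n (h M _) (key n _)

end Cochains

/-! ### Coinduced cochains as functions on slices. -/

section Slices

variable {R : Type w} [CommRing R] {Y : SSet.{u}} {J : Type u} [Category.{0} J]

/-- The simplices `y` of `Y` together with a morphism from `P(y)` to `t`. -/
def Slice (P : SimplicesCat Y ⥤ J) (t : J) (n : ℕ) : Type u :=
  Σ y : Y _⦋n⦌, (P.obj (simplex Y y) ⟶ t)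

/-- The faces of a simplex over `t`. -/
def Slice.face (P : SimplicesCat Y ⥤ J) (t : J) (n : ℕ) (i : Fin (n + 2))
    (z : Slice P t (n + 1)) : Slice P t n :=
  ⟨Y.δ i z.1, P.map (simplexHom Y (SimplexCategory.δ i) rfl) ≫ z.2⟩

variable (P : SimplicesCat Y ⥤ J) (M : J ⥤ ModuleCat.{w'} R)

/-- The component at `t` of a cochain with coinduced coefficients. -/
def sliceFunction {n : ℕ} (c : (cochainComplex (P ⋙ coinduced M)).X n) (t : J)
    (z : Slice P t n) : M.obj t :=
  (show ∀ y : Y _⦋n⦌, ∀ t, (P.obj (simplex Y y) ⟶ t) → M.obj t from c) z.1 t z.2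

/-- The cochain with coinduced coefficients that has the given components. -/
def ofSliceFunction {n : ℕ} (b : ∀ t, Slice P t n → M.obj t) :
    (cochainComplex (P ⋙ coinduced M)).X n :=
  (show ∀ y : Y _⦋n⦌, ∀ t, (P.obj (simplex Y y) ⟶ t) → M.obj t from fun y t f ↦ b t ⟨y, f⟩)

variable {P M}

lemma sliceFunction_injective {n : ℕ} {c c' : (cochainComplex (P ⋙ coinduced M)).X n}
    (h : ∀ t, sliceFunction P M c t = sliceFunction P M c' t) : c = c' := by
  funext y t f
  exact congrFun (h t) ⟨y, f⟩

/-- Transition maps of the coinduced system only precompose the arrows to `t`, so on the component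
at `t` the values stay in the fixed module `M(t)`. -/
lemma sliceFunction_d {n : ℕ} (c : (cochainComplex (P ⋙ coinduced M)).X n) (t : J) :
    sliceFunction P M ((cochainComplex (P ⋙ coinduced M)).d n (n + 1) c) t =
      altCoface (Slice.face P t) n (sliceFunction P M c t) := by
  funext z
  have h := congrFun (congrFun (cochainComplex_d_apply (P ⋙ coinduced M) n c z.1) t) z.2
  refine h.trans ?_
  refine (congrFun (Finset.sum_apply t _ _) z.2).trans ?_
  exact Finset.sum_apply z.2 _ _

lemma exists_d_eq_of_faceAcyclic (h : ∀ t, FaceAcyclic (Slice.face P t) (M.obj t)) (n : ℕ)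
    (c : (cochainComplex (P ⋙ coinduced M)).X (n + 1))
    (hc : (cochainComplex (P ⋙ coinduced M)).d (n + 1) (n + 2) c = 0) :
    ∃ b, (cochainComplex (P ⋙ coinduced M)).d n (n + 1) b = c := by
  choose b hb using fun t ↦ (h t).succ n (sliceFunction P M c t)
    (by rw [← sliceFunction_d, hc]; rfl)
  refine ⟨ofSliceFunction P M b, sliceFunction_injective fun t ↦ ?_⟩
  rw [sliceFunction_d]
  exact hb t

lemma exists_const_of_faceAcyclic (h : ∀ t, FaceAcyclic (Slice.face P t) (M.obj t))
    (c : (cochainComplex (P ⋙ coinduced M)).X 0)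
    (hc : (cochainComplex (P ⋙ coinduced M)).d 0 1 c = 0) :
    ∃ k : ∀ t, M.obj t, c = ofSliceFunction P M (fun t _ ↦ k t) := by
  choose k hk using fun t ↦ (h t).zero (sliceFunction P M c t)
    (by rw [← sliceFunction_d, hc]; rfl)
  exact ⟨k, sliceFunction_injective fun t ↦ funext (hk t)⟩

lemma d_const_eq_zero (k : ∀ t, M.obj t) :
    (cochainComplex (P ⋙ coinduced M)).d 0 1 (ofSliceFunction P M (fun t _ ↦ k t)) = 0 := by
  apply sliceFunction_injective
  intro t
  rw [sliceFunction_d]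
  funext z
  change ∑ i : Fin 2, (-1 : ℤ) ^ (i : ℕ) • k t = 0
  simp

end Slices

section Acyclic

variable {R : Type w} [CommRing R] {X Y : SSet.{u}}

/-- Both complexes have cohomology `∏_t M(t)`, concentrated in degree `0`, and the map is the
identity on these constants. -/
lemma coneExactAt_coinduced (f : Y ⟶ X) (M : CoefficientSystem.{w'} R X)
    (hX : ∀ t, FaceAcyclic (Slice.face (𝟭 (SimplicesCat X)) t) (M.obj t))
    (hY : ∀ t, FaceAcyclic (Slice.face (simplicesMap f) t) (M.obj t)) (n : ℕ) :
    ConeExactAt (cochainComplexMap f (coinduced M)) n := by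
  match n with
  | 0 =>
    intro c hc hc'
    obtain ⟨k, rfl⟩ := exists_const_of_faceAcyclic hX c hc
    suffices k = 0 by subst this; rfl
    funext t
    -- A constant that vanishes on a nonempty slice is zero.
    obtain ⟨y, g⟩ := (hY t).nonempty.some
    exact congrFun (congrFun (congrFun hc' y) t) g
  | 1 =>
    intro c b hc hcb
    obtain ⟨a, rfl⟩ := exists_d_eq_of_faceAcyclic hX 0 c hc
    -- The defect of the primitive `a` is a family of constants on the slices over `Y`. The same
    -- constants are cocycles on `X`, so adding them to `a` keeps its coboundary.
    obtain ⟨k, hk⟩ := exists_const_of_faceAcyclic hY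
      (b - (cochainComplexMap f (coinduced M)).f 0 a)
      (by rw [map_sub, ← hom_d_apply]; exact sub_eq_zero.2 hcb.symm)
    refine ⟨a + ofSliceFunction (𝟭 (SimplicesCat X)) M (fun t _ ↦ k t), ?_, ?_⟩
    · rw [map_add]
      exact (congrArg _ (d_const_eq_zero (P := 𝟭 (SimplicesCat X)) k)).trans (add_zero _)
    · rw [map_add]
      exact (add_eq_of_eq_sub' hk.symm)
  | n + 2 =>
    intro c b hc hcb
    obtain ⟨a, rfl⟩ := exists_d_eq_of_faceAcyclic hX (n + 1) c hc
    obtain ⟨e, he⟩ := exists_d_eq_of_faceAcyclic hY n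
      ((cochainComplexMap f (coinduced M)).f (n + 1) a - b)
      (by rw [map_sub, ← hom_d_apply]; exact sub_eq_zero.2 hcb)
    exact ⟨a, e, rfl, (add_eq_of_eq_sub' he).symm⟩

end Acyclic

/-! ### Chains in comma categories and in categories of elements. -/

section Lifts

variable {J : Type*} [Category* J]

/-- The functor to a category of elements given by a functor to the base and a compatible
family of elements. -/
def elementsLift {K : Type*} [Category* K] {H : K ⥤ Type u} (k : J ⥤ K) (s : ∀ j, H.obj (k.obj j))
    (hs : ∀ {i j} (f : i ⟶ j), H.map (k.map f) (s i) = s j) : J ⥤ H.Elements where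
  obj j := ⟨k.obj j, s j⟩
  map f := ⟨k.map f, hs f⟩
  map_id j := Subtype.ext (k.map_id j)
  map_comp f g := Subtype.ext (k.map_comp f g)

lemma map_map_apply_of_comp_eq {K : Type*} [Category* K] (H : K ⥤ Type u) {a b c : K} (f : a ⟶ b)
    (g : b ⟶ c) {h : a ⟶ c} (e : f ≫ g = h) (x : H.obj a) : H.map g (H.map f x) = H.map h x := by
  subst e
  simp

lemma map_apply_of_eq_id {K : Type*} [Category* K] (H : K ⥤ Type u) {a : K} {f : a ⟶ a}
    (e : f = 𝟙 a) (x : H.obj a) : H.map f x = x := by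
  subst e
  simp

lemma elementsLift_congr {K : Type*} [Category* K] {H : K ⥤ Type u} (k : J ⥤ K)
    {s s' : ∀ j, H.obj (k.obj j)}
    (hs : ∀ {i j} (f : i ⟶ j), H.map (k.map f) (s i) = s j)
    (hs' : ∀ {i j} (f : i ⟶ j), H.map (k.map f) (s' i) = s' j) (h : ∀ j, s j = s' j) :
    elementsLift k s hs = elementsLift k s' hs' := by
  obtain rfl : s = s' := funext h
  rfl

variable {C D : Type u} [SmallCategory C] [SmallCategory D] {φ : C ⥤ D}

/-- The functor to a comma category given by a functor to `C` and a compatible family of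
morphisms. -/
def structuredLift {d : D} (G : J ⥤ C) (ν : ∀ j, d ⟶ φ.obj (G.obj j))
    (hν : ∀ {i j} (f : i ⟶ j), ν i ≫ φ.map (G.map f) = ν j) : J ⥤ StructuredArrow d φ where
  obj j := StructuredArrow.mk (ν j)
  map f := StructuredArrow.homMk (G.map f) (hν f)

lemma structuredLift_congr {d : D} (G : J ⥤ C) {ν ν' : ∀ j, d ⟶ φ.obj (G.obj j)}
    (hν : ∀ {i j} (f : i ⟶ j), ν i ≫ φ.map (G.map f) = ν j)
    (hν' : ∀ {i j} (f : i ⟶ j), ν' i ≫ φ.map (G.map f) = ν' j) (h : ∀ j, ν j = ν' j) :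
    structuredLift G ν hν = structuredLift G ν' hν' := by
  obtain rfl : ν = ν' := funext h
  rfl

lemma chain_comp {n : ℕ} {d : D} (G : ComposableArrows C n) (μ : d ⟶ φ.obj (G.obj 0))
    {i j : Fin (n + 1)} (f : i ⟶ j) :
    (μ ≫ φ.map (G.map (homOfLE (Fin.zero_le i)))) ≫ φ.map (G.map f) =
      μ ≫ φ.map (G.map (homOfLE (Fin.zero_le j))) := by
  rw [Category.assoc, ← φ.map_comp, ← G.map_comp]
  rfl

variable (φ) in
/-- The chain in `d\φ` that lies over a chain in `C` and starts at `μ`. -/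
def underChain {n : ℕ} {d : D} (G : ComposableArrows C n) (μ : d ⟶ φ.obj (G.obj 0)) :
    ComposableArrows (StructuredArrow d φ) n :=
  structuredLift G (fun j ↦ μ ≫ φ.map (G.map (homOfLE (Fin.zero_le j)))) (chain_comp G μ)

/-- A chain in `d\φ` is determined by its image in `C` and its first arrow, the other arrows being
composites. -/
lemma exists_underChain_eq {n : ℕ} {d : D} (G : ComposableArrows C n)
    (x : ComposableArrows (StructuredArrow d φ) n) (h : G = x ⋙ StructuredArrow.proj d φ) :
    ∃ μ, underChain φ G μ = x := by
  subst h
  exact ⟨(x.obj 0).hom, structuredLift_congr (x ⋙ StructuredArrow.proj d φ) (chain_comp _ _)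
    (fun f ↦ StructuredArrow.w (x.map f)) (fun j ↦ StructuredArrow.w (x.map _))⟩

end Lifts

/-! ### The slices over a simplex of the nerve of `C`, and their contraction. -/

section Slices

variable {C D : Type u} [SmallCategory C] [SmallCategory D]

lemma exists_homEquivFunctor_symm_op {m : SimplexCategory} {n : ℕ} (f : op m ⟶ op ⦋n⦌) :
    ∃ x : ComposableArrows (Fin (m.len + 1)) n, (SimplexCategory.homEquivFunctor.symm x).op = f :=
  ⟨SimplexCategory.homEquivFunctor f.unop,
    Quiver.Hom.unop_inj (SimplexCategory.homEquivFunctor.symm_apply_apply f.unop)⟩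

/-- The simplices of the nerve over a simplex are the simplices of the nerve of an ordinal. -/
def nerveSliceEquiv {m : SimplexCategory} (τ : (nerve C).obj (op m)) (n : ℕ) :
    (nerve (Fin (m.len + 1))) _⦋n⦌ ≃
      Slice (𝟭 (SimplicesCat (nerve C))) (simplex (nerve C) τ) n where
  toFun x := ⟨(show ComposableArrows (Fin (m.len + 1)) n from x) ⋙ τ,
    simplexHom (nerve C) (SimplexCategory.homEquivFunctor.symm x) rfl⟩
  invFun s := SimplexCategory.homEquivFunctor s.2.unop.val.unop
  left_inv x := rfl
  right_inv := by
    rintro ⟨σ, ⟨⟨f, h⟩⟩⟩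
    obtain ⟨x, rfl⟩ := exists_homEquivFunctor_symm_op f
    change (show ComposableArrows (Fin (m.len + 1)) n from x) ⋙ τ = σ at h
    subst h
    rfl

/-- The last element of the ordinal is terminal. -/
lemma faceAcyclic_slice_nerve (t : SimplicesCat (nerve C)) (A : Type w) [AddCommGroup A] :
    FaceAcyclic (Slice.face (𝟭 (SimplicesCat (nerve C))) t) A := by
  obtain ⟨⟨⟨m⟩, τ⟩⟩ := t
  refine (faceAcyclic_nerve (E := Fin (m.len + 1)) (e₀ := Fin.last _)
    (G := (Functor.const _).obj (Fin.last _)) { app := fun i ↦ homOfLE (Fin.le_last i) }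
    (𝟙 _) A).of_equiv (nerveSliceEquiv τ) fun n i z ↦ rfl

variable (φ : C ⥤ D) {m : ℕ} (τ : ComposableArrows C m)

lemma comp_chain {d d' : D} {i j k : Fin (m + 1)} (g : d' ⟶ d) (μ : d ⟶ φ.obj (τ.obj i))
    (α : i ⟶ j) (β : j ⟶ k) (γ : i ⟶ k) :
    (g ≫ μ ≫ φ.map (τ.map α)) ≫ φ.map (τ.map β) = g ≫ μ ≫ φ.map (τ.map γ) := by
  obtain rfl : γ = α ≫ β := Subsingleton.elim _ _
  simp

lemma comp_chain' {d d' : D} {i j k : Fin (m + 1)} (g : d' ⟶ d) (μ : d ⟶ φ.obj (τ.obj i))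
    (α : i ⟶ j) (β : j ⟶ k) (γ : i ⟶ k) :
    g ≫ (μ ≫ φ.map (τ.map α)) ≫ φ.map (τ.map β) = g ≫ μ ≫ φ.map (τ.map γ) := by
  obtain rfl : γ = α ≫ β := Subsingleton.elim _ _
  simp

/-- The functor `(d, i) ↦ Hom(d, φ(τ(i)))`. -/
def chainHom : Dᵒᵖ × Fin (m + 1) ⥤ Type u where
  obj k := k.1.unop ⟶ φ.obj (τ.obj k.2)
  map g := ↾fun μ ↦ g.1.unop ≫ μ ≫ φ.map (τ.map g.2)
  map_id k := by
    ext μ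
    change 𝟙 _ ≫ μ ≫ φ.map (τ.map (𝟙 _)) = μ
    simp
  map_comp g h := by
    ext μ
    change (h.1.unop ≫ g.1.unop) ≫ μ ≫ φ.map (τ.map (g.2 ≫ h.2)) =
      h.1.unop ≫ (g.1.unop ≫ μ ≫ φ.map (τ.map g.2)) ≫ φ.map (τ.map h.2)
    simp

/-- The endofunctor `(d, i, μ) ↦ (d, m, μ')`. -/
def chainHomPush : (chainHom φ τ).Elements ⥤ (chainHom φ τ).Elements where
  obj a := ⟨(a.1.1, Fin.last m), a.2 ≫ φ.map (τ.map (homOfLE (Fin.le_last _)))⟩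
  map {a b} g := ⟨(g.1.1, 𝟙 _), by
    have h : g.1.1.unop ≫ a.2 ≫ φ.map (τ.map g.1.2) = b.2 := g.2
    change g.1.1.unop ≫ (a.2 ≫ φ.map (τ.map _)) ≫ φ.map (τ.map (𝟙 _)) = b.2 ≫ _
    refine Eq.trans ?_ (congrArg (· ≫ φ.map (τ.map _)) h)
    exact (comp_chain' φ τ _ _ _ _ (homOfLE (Fin.le_last _))).trans
      (comp_chain φ τ _ _ _ _ _).symm⟩

/-- The natural transformation `(d, i, μ) ⟶ (d, m, μ')`. -/
def toChainHomPush : 𝟭 (chainHom φ τ).Elements ⟶ chainHomPush φ τ where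
  app a := ⟨(𝟙 _, homOfLE (Fin.le_last _)), Category.id_comp _⟩
  naturality a b g := by
    refine Subtype.ext (Prod.ext ?_ rfl)
    exact (Category.comp_id _).trans (Category.id_comp _).symm

/-- The object `(φ(τ(m)), m, id)`. -/
def chainHomBase : (chainHom φ τ).Elements :=
  ⟨(op (φ.obj (τ.obj (Fin.last m))), Fin.last m), 𝟙 (φ.obj (τ.obj (Fin.last m)))⟩

/-- The natural transformation `(φ(τ(m)), m, id) ⟶ (d, m, μ')`. -/
def constToChainHomPush :
    (Functor.const (chainHom φ τ).Elements).obj (chainHomBase φ τ) ⟶ chainHomPush φ τ where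
  app a := ⟨(Quiver.Hom.op (a.2 ≫ φ.map (τ.map (homOfLE (Fin.le_last _)))), 𝟙 _), by
    change (a.2 ≫ φ.map (τ.map _)) ≫ 𝟙 _ ≫ φ.map (τ.map (𝟙 _)) = a.2 ≫ _
    simp⟩
  naturality a b g := by
    refine Subtype.ext (Prod.ext ?_ rfl)
    refine (Category.id_comp _).trans (Quiver.Hom.unop_inj ?_)
    have h : g.1.1.unop ≫ a.2 ≫ φ.map (τ.map g.1.2) = b.2 := g.2
    change b.2 ≫ φ.map (τ.map _) = g.1.1.unop ≫ a.2 ≫ φ.map (τ.map _)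
    exact (congrArg (· ≫ φ.map (τ.map _)) h).symm.trans (comp_chain φ τ _ _ _ _ _)

/-- A chain in `Dᵒᵖ`, a chain in an ordinal and a morphism between the first objects. -/
def ChainPair (n : ℕ) : Type u :=
  Σ (k : ComposableArrows Dᵒᵖ n × ComposableArrows (Fin (m + 1)) n),
    ((k.1.obj 0).unop ⟶ φ.obj (τ.obj (k.2.obj 0)))

/-- A chain in a category of elements is a chain in the base and an element over its source. -/
def chainHomElementsEquiv (n : ℕ) :
    ComposableArrows (chainHom φ τ).Elements n ≃ ChainPair φ τ n where
  toFun w := ⟨(w ⋙ CategoryOfElements.π _ ⋙ CategoryTheory.Prod.fst _ _,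
      w ⋙ CategoryOfElements.π _ ⋙ CategoryTheory.Prod.snd _ _),
    (w.obj 0).2⟩
  invFun a := elementsLift (Functor.prod' a.1.1 a.1.2)
    (fun j ↦ (chainHom φ τ).map ((Functor.prod' a.1.1 a.1.2).map (homOfLE (Fin.zero_le j))) a.2)
    (fun f ↦ map_map_apply_of_comp_eq (chainHom φ τ)
      ((Functor.prod' a.1.1 a.1.2).map (homOfLE (Fin.zero_le _)))
      ((Functor.prod' a.1.1 a.1.2).map f) ((Functor.prod' a.1.1 a.1.2).map_comp _ _).symm a.2)
  left_inv w := elementsLift_congr (w ⋙ CategoryOfElements.π _) _ (fun f ↦ (w.map f).2)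
    (fun j ↦ (w.map (homOfLE (Fin.zero_le j))).2)
  right_inv := by
    rintro ⟨⟨σ, f⟩, μ⟩
    exact congrArg (Sigma.mk _) (map_apply_of_eq_id (chainHom φ τ)
      ((Functor.prod' σ f).map_id 0) μ)

/-- The simplex of the homotopy colimit over a simplex of the nerve of `C`. -/
def sliceOfChainPair {n : ℕ} (a : ChainPair φ τ n) :
    Slice (simplicesMap (upsilon φ)) (simplex (nerve C) (n := ⦋m⦌) τ) n :=
  ⟨⟨a.1.1, underChain φ (a.1.2 ⋙ τ) a.2⟩,
    simplexHom (nerve C) (SimplexCategory.homEquivFunctor.symm a.1.2) rfl⟩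

/-- The types of `f` and `f'` depend on `x` and `x'`; only their underlying maps of ordinals need
comparing. -/
lemma slice_ext {n : ℕ} (σ : ComposableArrows Dᵒᵖ n)
    {x x' : ((nerveUnder φ).obj (σ.obj 0)).obj (op ⦋n⦌)} (h : x = x')
    (f : (simplicesMap (upsilon φ)).obj (simplex (hocolim (nerveUnder φ)) (n := ⦋n⦌) ⟨σ, x⟩) ⟶
      simplex (nerve C) (n := ⦋m⦌) τ)
    (f' : (simplicesMap (upsilon φ)).obj (simplex (hocolim (nerveUnder φ)) (n := ⦋n⦌) ⟨σ, x'⟩) ⟶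
      simplex (nerve C) (n := ⦋m⦌) τ) (hf : f.unop.val = f'.unop.val) :
    (⟨⟨σ, x⟩, f⟩ : Slice (simplicesMap (upsilon φ)) (simplex (nerve C) (n := ⦋m⦌) τ) n) =
      ⟨⟨σ, x'⟩, f'⟩ := by
  subst h
  exact congrArg (Sigma.mk _) (Quiver.Hom.unop_inj (Subtype.ext hf))

lemma sliceOfChainPair_bijective (n : ℕ) :
    Function.Bijective (sliceOfChainPair φ τ (n := n)) := by
  constructor
  · let r : Slice (simplicesMap (upsilon φ)) (simplex (nerve C) (n := ⦋m⦌) τ) n →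
        ChainPair φ τ n :=
      fun s ↦ ⟨(s.1.1, SimplexCategory.homEquivFunctor s.2.unop.val.unop),
        -- The first arrow ends at the first object of the projected chain, which equals that of the
        -- restricted `τ` only propositionally.
        (s.1.2.obj 0).hom ≫ eqToHom
          (congrArg (fun F : ComposableArrows C n ↦ φ.obj (F.obj 0)) s.2.unop.property.symm)⟩
    refine Function.LeftInverse.injective (g := r) ?_
    rintro ⟨⟨σ, f⟩, μ⟩
    refine congrArg (Sigma.mk _) ?_
    change (μ ≫ φ.map (τ.map (𝟙 _))) ≫ 𝟙 _ = μ
    simp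
  · rintro ⟨⟨σ, x⟩, ⟨⟨f, h⟩⟩⟩
    obtain ⟨z, rfl⟩ := exists_homEquivFunctor_symm_op f
    obtain ⟨μ, rfl⟩ := exists_underChain_eq (φ := φ) (z ⋙ τ) x h
    exact ⟨⟨(σ, z), μ⟩, rfl⟩

/-- The simplices of the homotopy colimit over a simplex of `N(C)` are the simplices of the nerve of
a category of elements. -/
noncomputable def chainHomSliceEquiv (n : ℕ) :
    (nerve (chainHom φ τ).Elements) _⦋n⦌ ≃
      Slice (simplicesMap (upsilon φ)) (simplex (nerve C) (n := ⦋m⦌) τ) n :=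
  (chainHomElementsEquiv φ τ n).trans (Equiv.ofBijective _ (sliceOfChainPair_bijective φ τ n))

lemma chainHomSliceEquiv_face (n : ℕ) (i : Fin (n + 2))
    (w : (nerve (chainHom φ τ).Elements) _⦋n + 1⦌) :
    chainHomSliceEquiv φ τ n ((nerve _).δ i w) =
      Slice.face _ _ n i (chainHomSliceEquiv φ τ (n + 1) w) := by
  refine slice_ext φ τ _ ?_ _ _ ?_
  · let x := (Slice.face _ _ n i (chainHomSliceEquiv φ τ (n + 1) w)).1
    let y : ComposableArrows (StructuredArrow (x.1.obj 0).unop φ) n := x.2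
    refine structuredLift_congr _ (chain_comp _ _) (fun f ↦ StructuredArrow.w (y.map f)) fun j ↦ ?_
    -- The face has first vertex `i.succAbove 0`, which differs from `0` only for `i = 0`. The
    -- morphism of elements from vertex `0` to it identifies the first arrows on the two sides.
    let g := (show ComposableArrows (chainHom φ τ).Elements (n + 1) from w).map
      (homOfLE (Fin.zero_le (i.succAbove 0)))
    have h : g.1.1.unop ≫ _ ≫ φ.map (τ.map g.1.2) = _ := g.2
    exact (congrArg (· ≫ φ.map (τ.map _)) h).symm.trans (comp_chain φ τ _ _ _ _ _)
  · rfl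

/-- The slice is the pullback of `υ` along the simplex `τ`, identified with the nerve of `(chainHom
φ τ).Elements`, which contracts onto `(φ(τ(m)), m, id)`. -/
lemma faceAcyclic_slice_upsilon (t : SimplicesCat (nerve C)) (A : Type w) [AddCommGroup A] :
    FaceAcyclic (Slice.face (simplicesMap (upsilon φ)) t) A := by
  obtain ⟨⟨⟨⟨m⟩⟩, τ⟩⟩ := t
  exact (faceAcyclic_nerve (toChainHomPush φ τ) (constToChainHomPush φ τ) A).of_equiv
    (chainHomSliceEquiv φ τ) (chainHomSliceEquiv_face φ τ)

end Slices

end ThomasonCohomology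

theorem mainTheorem6 {C D : Type u} [SmallCategory C] [SmallCategory D] (φ : C ⥤ D)
    {R : Type w} [CommRing R]
    (M : ThomasonCohomology.CoefficientSystem.{w'} R (nerve C)) (n : ℕ) :
    IsIso (ThomasonCohomology.cohomologyMap (ThomasonCohomology.upsilon φ) M n :
      ThomasonCohomology.thomasonCohomology M n ⟶
        ThomasonCohomology.cohomology (M.pullback (ThomasonCohomology.upsilon φ)) n) := by
  have h (k : ℕ) : ThomasonCohomology.ConeExactAt
      (ThomasonCohomology.cochainComplexMap (ThomasonCohomology.upsilon φ) M) k :=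
    ThomasonCohomology.coneExactAt_of_coinduced _
      (fun M ↦ ThomasonCohomology.coneExactAt_coinduced _ M
        (fun t ↦ ThomasonCohomology.faceAcyclic_slice_nerve t _)
        (fun t ↦ ThomasonCohomology.faceAcyclic_slice_upsilon φ t _))
      (fun M ↦ ThomasonCohomology.coneExactAt_coinduced _ M
        (fun t ↦ ThomasonCohomology.faceAcyclic_slice_nerve t _)
        (fun t ↦ ThomasonCohomology.faceAcyclic_slice_upsilon φ t _)) M k
  exact (h n).isIso_homologyMap (h (n + 1))
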